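/- A unit rhombus is a rhombus in the Euclidean plane with side length $1$ and acute angle $\pi/3$. Let $E$ and $F$ be two adjacent unit rhombuses that share a side (that is, they have a full side in common and meet only in that side) but have different orientations (that is, neither is a translate of the other). Let $X$ and $Y$ be independent random points, with $X$ uniformly distributed in $E$ and $Y$ uniformly distributed in $F$. Then the Euclidean distance $D=|X-Y|$ is absolutely continuous with probability density function $$ f(d)=2d\cdot\begin{cases} \frac43 d-\left(\frac13+\frac{2\pi}{9\sqrt3}\right)d^2, & 0\le d\le \frac{\sqrt3}{2},\\[4pt] -\frac{4}{\sqrt3}\left(\frac{d^2}{3}+1\right)\arcsin\frac{\sqrt3}{2d}+\left(\frac{4\pi}{9\sqrt3}-\frac13\right)d^2+\frac43 d-\frac53\sqrt{4d^2-3}+\frac{2\pi}{\sqrt3}, & \frac{\sqrt3}{2}< d\le 1,\\[4pt] -\frac{2}{\sqrt3}\left(\frac{d^2}{3}+2\right)\arcsin\frac{\sqrt3}{2d}+\left(\frac{2\pi}{9\sqrt3}+\frac13\right)d^2-\frac32\sqrt{4d^2-3}+\frac{2\pi}{\sqrt3}+\frac12, & 1< d\le \sqrt3,\\[4pt] \frac{2}{\sqrt3}\left(\frac{d^2}{3}+4\right)\arcsin\frac{\sqrt3}{d}-\left(\frac{2\pi}{9\sqrt3}+\frac13\right)d^2+\frac{10}{3}\sqrt{d^2-3}-\frac{8\pi}{3\sqrt3}-2,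 & \sqrt3< d\le 2,\\[4pt] 0, & \text{otherwise.} \end{cases} $$ That is, $f\ge 0$, and the law of $D$ has density $f$ with respect to Lebesgue measure on $\mathbb R$. -/

import Mathlib

open MeasureTheory ProbabilityTheory Set

/-- The Euclidean plane. -/
abbrev Plane : Type := EuclideanSpace ℝ (Fin 2)

/-- A unit rhombus: a rhombus of side length `1` with an acute angle `π / 3`. It is given by a
vertex `corner` at which the angle is `π / 3`, and the two unit edge vectors `u`, `v` there. -/
structure UnitRhombus where
  corner : Plane
  u : Plane
  v : Plane
  norm_u : ‖u‖ = 1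
  norm_v : ‖v‖ = 1
  angle_uv : InnerProductGeometry.angle u v = Real.pi / 3

namespace UnitRhombus

/-- The closed region of the plane bounded by the rhombus. -/
def region (R : UnitRhombus) : Set Plane :=
  {x | ∃ s ∈ Icc (0 : ℝ) 1, ∃ t ∈ Icc (0 : ℝ) 1, x = R.corner + s • R.u + t • R.v}

/-- The set of the four sides of the rhombus, each of them a closed segment. -/
def sides (R : UnitRhombus) : Set (Set Plane) :=
  {segment ℝ R.corner (R.corner + R.u),
   segment ℝ R.corner (R.corner + R.v),
   segment ℝ (R.corner + R.u) (R.corner + R.u + R.v),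
   segment ℝ (R.corner + R.v) (R.corner + R.u + R.v)}

/-- Two rhombuses are adjacent and share a side: they have a common (full) side, and they meet
in that side only. -/
def ShareSide (E F : UnitRhombus) : Prop :=
  ∃ S : Set Plane, S ∈ E.sides ∧ S ∈ F.sides ∧ E.region ∩ F.region = S

/-- Two unit rhombuses have the same orientation when one is a translate of the other. -/
def SameOrientation (E F : UnitRhombus) : Prop :=
  ∃ w : Plane, F.region = (fun x => w + x) '' E.region

end UnitRhombus

/-- The explicit density of the distance (zero outside `[0, 2]`). -/
noncomputable def rhombusEdgeDensity (d : ℝ) : ℝ :=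
  2 * d *
    (if d < 0 then 0
    else if d ≤ √3 / 2 then
      4 / 3 * d - (1 / 3 + 2 * Real.pi / (9 * √3)) * d ^ 2
    else if d ≤ 1 then
      -(4 / √3) * (d ^ 2 / 3 + 1) * Real.arcsin (√3 / (2 * d))
        + (4 * Real.pi / (9 * √3) - 1 / 3) * d ^ 2 + 4 / 3 * d
        - 5 / 3 * √(4 * d ^ 2 - 3) + 2 * Real.pi / √3
    else if d ≤ √3 then
      -(2 / √3) * (d ^ 2 / 3 + 2) * Real.arcsin (√3 / (2 * d))
        + (2 * Real.pi / (9 * √3) + 1 / 3) * d ^ 2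
        - 3 / 2 * √(4 * d ^ 2 - 3) + 2 * Real.pi / √3 + 1 / 2
    else if d ≤ 2 then
      2 / √3 * (d ^ 2 / 3 + 4) * Real.arcsin (√3 / d)
        - (2 * Real.pi / (9 * √3) + 1 / 3) * d ^ 2
        + 10 / 3 * √(d ^ 2 - 3) - 8 * Real.pi / (3 * √3) - 2
    else 0)

open scoped ENNReal

/-- The density of the difference of two independent uniform variables on `[0, 1]`. -/
noncomputable def tent (x : ℝ) : ℝ := max 0 (1 - |x|)

theorem continuous_tent : Continuous tent := by unfold tent; fun_prop

theorem tent_nonneg (x : ℝ) : 0 ≤ tent x := le_max_left _ _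

theorem tent_neg (x : ℝ) : tent (-x) = tent x := by simp [tent]

theorem tent_intervalIntegrable (a b : ℝ) : IntervalIntegrable tent volume a b :=
  continuous_tent.intervalIntegrable a b

/-- The odd primitive of `tent`. -/
noncomputable def tentPrimitive (p : ℝ) : ℝ := ∫ x in (0 : ℝ)..p, tent x

theorem tentPrimitive_sub (a b : ℝ) : tentPrimitive b - tentPrimitive a = ∫ x in a..b, tent x :=
  intervalIntegral.integral_interval_sub_left (tent_intervalIntegrable _ _)
    (tent_intervalIntegrable _ _)

theorem monotone_tentPrimitive : Monotone tentPrimitive := fun a b hab => by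
  have h := tentPrimitive_sub a b
  have h2 : 0 ≤ ∫ x in a..b, tent x :=
    intervalIntegral.integral_nonneg hab fun x _ => tent_nonneg x
  linarith

theorem continuous_tentPrimitive : Continuous tentPrimitive :=
  intervalIntegral.continuous_primitive (fun a b => tent_intervalIntegrable a b) 0

theorem tentPrimitive_neg (p : ℝ) : tentPrimitive (-p) = -tentPrimitive p := by
  have h := intervalIntegral.integral_comp_neg (a := 0) (b := p) tent
  simp only [tent_neg, neg_zero] at h
  rw [tentPrimitive, tentPrimitive, h, intervalIntegral.integral_symm]

theorem tentPrimitive_of_mem_Icc {p : ℝ} (h0 : 0 ≤ p) (h1 : p ≤ 1) :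
    tentPrimitive p = p - p ^ 2 / 2 := by
  have h : tentPrimitive p = ∫ x in (0 : ℝ)..p, (1 - x) := by
    refine intervalIntegral.integral_congr fun x hx => ?_
    rw [uIcc_of_le h0] at hx
    rw [tent, abs_of_nonneg hx.1, max_eq_right (by linarith [hx.2])]
  rw [h, intervalIntegral.integral_sub (by simp) (by simp)]
  simp

theorem tentPrimitive_of_one_le {p : ℝ} (h1 : 1 ≤ p) : tentPrimitive p = 1 / 2 := by
  have h := tentPrimitive_sub 1 p
  have h2 : ∫ x in (1 : ℝ)..p, tent x = ∫ x in (1 : ℝ)..p, (0 : ℝ) := by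
    refine intervalIntegral.integral_congr fun x hx => ?_
    rw [uIcc_of_le h1] at hx
    rw [tent, abs_of_nonneg (by linarith [hx.1]), max_eq_left (by linarith [hx.1])]
  rw [h2, tentPrimitive_of_mem_Icc zero_le_one le_rfl, intervalIntegral.integral_zero] at h
  linarith

theorem tentPrimitive_of_mem_Icc_neg {p : ℝ} (h0 : p ≤ 0) (h1 : -1 ≤ p) :
    tentPrimitive p = p + p ^ 2 / 2 := by
  have h := tentPrimitive_of_mem_Icc (p := -p) (by linarith) (by linarith)
  rw [tentPrimitive_neg] at h
  linarith

theorem tentPrimitive_of_le_neg_one {p : ℝ} (h1 : p ≤ -1) : tentPrimitive p = -1 / 2 := by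
  have h := tentPrimitive_of_one_le (p := -p) (by linarith)
  rw [tentPrimitive_neg] at h
  linarith

/-- `f` is integrable on the interval between `a` and `b`, with integral `v`. -/
def HasIntervalIntegral (f : ℝ → ℝ) (a b v : ℝ) : Prop :=
  IntervalIntegrable f volume a b ∧ ∫ x in a..b, f x = v

theorem HasIntervalIntegral.trans {f : ℝ → ℝ} {a b c v w : ℝ} (h1 : HasIntervalIntegral f a b v)
    (h2 : HasIntervalIntegral f b c w) : HasIntervalIntegral f a c (v + w) :=
  ⟨h1.1.trans h2.1, by
    rw [← intervalIntegral.integral_add_adjacent_intervals h1.1 h2.1, h1.2, h2.2]⟩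

theorem HasIntervalIntegral.congr {f g : ℝ → ℝ} {a b v : ℝ} (h : HasIntervalIntegral g a b v)
    (hab : a ≤ b) (hfg : ∀ x ∈ Ioo a b, f x = g x) : HasIntervalIntegral f a b v := by
  have hae : g =ᵐ[volume.restrict (uIoc a b)] f := by
    rw [uIoc_of_le hab, ← restrict_Ioo_eq_restrict_Ioc]
    exact (ae_restrict_iff' measurableSet_Ioo).2 (Filter.Eventually.of_forall fun x hx =>
      (hfg x hx).symm)
  refine ⟨h.1.congr_ae hae, ?_⟩
  rw [← h.2]
  exact intervalIntegral.integral_congr_ae_restrict hae.symm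

theorem hasIntervalIntegral_quadratic_cos (A B C c e a b : ℝ) :
    HasIntervalIntegral (fun θ => A + B * (c * Real.cos (θ - e)) + C * (c * Real.cos (θ - e)) ^ 2)
      a b (A * (b - a) + B * (c * Real.sin (b - e) - c * Real.sin (a - e))
        + C / 2 * (c ^ 2 * (b - a) + (c * Real.sin (b - e)) * (c * Real.cos (b - e))
          - (c * Real.sin (a - e)) * (c * Real.cos (a - e)))) := by
  have hi : IntervalIntegrable (fun θ => A + B * (c * Real.cos (θ - e))
      + C * (c * Real.cos (θ - e)) ^ 2) volume a b := by
    apply Continuous.intervalIntegrable; fun_prop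
  have hd : ∀ θ : ℝ, HasDerivAt (fun θ : ℝ => A * θ + B * (c * Real.sin (θ - e))
      + C / 2 * (c ^ 2 * θ + (c * Real.sin (θ - e)) * (c * Real.cos (θ - e))))
      (A + B * (c * Real.cos (θ - e)) + C * (c * Real.cos (θ - e)) ^ 2) θ := by
    intro θ
    have hs : HasDerivAt (fun θ => c * Real.sin (θ - e)) (c * (Real.cos (θ - e) * 1)) θ :=
      (((hasDerivAt_id θ).sub_const e).sin).const_mul c
    have hc : HasDerivAt (fun θ => c * Real.cos (θ - e)) (c * (-Real.sin (θ - e) * 1)) θ :=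
      (((hasDerivAt_id θ).sub_const e).cos).const_mul c
    have h := (((hasDerivAt_id θ).const_mul A).add (hs.const_mul B)).add
      ((((hasDerivAt_id θ).const_mul (c ^ 2)).add (hs.mul hc)).const_mul (C / 2))
    refine HasDerivAt.congr_deriv h ?_
    have := Real.sin_sq_add_cos_sq (θ - e)
    linear_combination (-C / 2 * c ^ 2) * this
  refine ⟨hi, ?_⟩
  rw [intervalIntegral.integral_eq_sub_of_hasDerivAt (fun θ _ => hd θ) hi]
  ring

theorem lt_mul_cos {c γ m x : ℝ} (hc : 0 < c) (hm : c * Real.sin γ = m)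
    (hγ : -(Real.pi / 2) ≤ γ) (hx : γ - Real.pi / 2 < x) (hx' : x < Real.pi / 2 - γ) :
    m < c * Real.cos x := by
  rw [← hm, ← Real.cos_pi_div_two_sub, ← Real.cos_abs x]
  exact mul_lt_mul_of_pos_left (Real.cos_lt_cos_of_nonneg_of_le_pi (abs_nonneg x) (by linarith)
    (abs_lt.2 ⟨by linarith, hx'⟩)) hc

theorem mul_cos_lt {c γ m x : ℝ} (hc : 0 < c) (hm : c * Real.sin γ = m)
    (hγ : γ ≤ Real.pi / 2) (hx : Real.pi / 2 - γ < x) (hx' : x ≤ Real.pi) :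
    c * Real.cos x < m := by
  rw [← hm, ← Real.cos_pi_div_two_sub]
  exact mul_lt_mul_of_pos_left
    (Real.cos_lt_cos_of_nonneg_of_le_pi (by linarith) hx' hx) hc

theorem mul_cos_lt_of_neg {c γ m x : ℝ} (hc : 0 < c) (hm : c * Real.sin γ = m)
    (hγ : γ ≤ Real.pi / 2) (hx : x < γ - Real.pi / 2) (hx' : -Real.pi ≤ x) :
    c * Real.cos x < m := by
  rw [← Real.cos_neg]
  exact mul_cos_lt hc hm hγ (by linarith) (by linarith)

theorem lt_mul_sin {c γ m x : ℝ} (hc : 0 < c) (hm : c * Real.sin γ = m)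
    (hγ : -(Real.pi / 2) ≤ γ) (hx : γ < x) (hx' : x < Real.pi - γ) : m < c * Real.sin x := by
  rw [← Real.cos_sub_pi_div_two]
  exact lt_mul_cos hc hm hγ (by linarith) (by linarith)

theorem mul_sin_lt {c γ m x : ℝ} (hc : 0 < c) (hm : c * Real.sin γ = m)
    (hγ : γ ≤ Real.pi / 2) (hx : x < γ) (hx' : 0 ≤ x) : c * Real.sin x < m := by
  rw [← Real.cos_sub_pi_div_two]
  exact mul_cos_lt_of_neg hc hm hγ (by linarith) (by linarith [Real.pi_pos])

theorem mul_sin_lt_of_sub_lt {c γ m x : ℝ} (hc : 0 < c) (hm : c * Real.sin γ = m)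
    (hγ : γ ≤ Real.pi / 2) (hx : Real.pi - γ < x) (hx' : x ≤ Real.pi) : c * Real.sin x < m := by
  rw [← Real.cos_sub_pi_div_two]
  exact mul_cos_lt hc hm hγ (by linarith) (by linarith [Real.pi_pos])

/-- Half of the angular density of the difference vector at distance `c * √3 / 2`. -/
noncomputable def angularDensity (c θ : ℝ) : ℝ :=
  if c * Real.sin θ ≤ 1 then tentPrimitive (c * Real.cos (θ - Real.pi / 6))
  else if c * Real.sin θ ≤ 2 then tentPrimitive (1 - c * Real.cos (θ - Real.pi / 6))
  else 0

theorem angularDensity_eq_of_le_one {c θ : ℝ} (hw : c * Real.sin θ < 1) :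
    angularDensity c θ = tentPrimitive (c * Real.cos (θ - Real.pi / 6)) := if_pos hw.le

theorem angularDensity_eq_of_le_two {c θ : ℝ} (hw : 1 < c * Real.sin θ)
    (hw' : c * Real.sin θ ≤ 2) :
    angularDensity c θ = tentPrimitive (1 - c * Real.cos (θ - Real.pi / 6)) := by
  rw [angularDensity, if_neg hw.not_ge, if_pos hw']

theorem angularDensity_eq_zero {c θ : ℝ} (hw : 2 < c * Real.sin θ) : angularDensity c θ = 0 := by
  rw [angularDensity, if_neg (by linarith), if_neg hw.not_ge]

theorem hasIntervalIntegral_angularDensity (A B C : ℝ) {c a b : ℝ} (hab : a ≤ b)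
    (h : ∀ θ ∈ Ioo a b, angularDensity c θ = A + B * (c * Real.cos (θ - Real.pi / 6))
      + C * (c * Real.cos (θ - Real.pi / 6)) ^ 2) :
    HasIntervalIntegral (angularDensity c) a b
      (A * (b - a) + B * (c * Real.sin (b - Real.pi / 6) - c * Real.sin (a - Real.pi / 6))
        + C / 2 * (c ^ 2 * (b - a)
          + (c * Real.sin (b - Real.pi / 6)) * (c * Real.cos (b - Real.pi / 6))
          - (c * Real.sin (a - Real.pi / 6)) * (c * Real.cos (a - Real.pi / 6)))) :=
  (hasIntervalIntegral_quadratic_cos A B C c (Real.pi / 6) a b).congr hab h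

theorem angle_zero (c : ℝ) : c * Real.sin (0 - Real.pi / 6) = -c / 2 ∧
    c * Real.cos (0 - Real.pi / 6) = √3 / 2 * c := by
  rw [zero_sub, Real.sin_neg, Real.cos_neg, Real.sin_pi_div_six, Real.cos_pi_div_six]
  constructor <;> ring

theorem angle_two_thirds (c : ℝ) : c * Real.sin (2 * Real.pi / 3 - Real.pi / 6) = c ∧
    c * Real.cos (2 * Real.pi / 3 - Real.pi / 6) = 0 := by
  rw [show 2 * Real.pi / 3 - Real.pi / 6 = Real.pi / 2 by ring, Real.sin_pi_div_two,
    Real.cos_pi_div_two]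
  constructor <;> ring

theorem angle_pi (c : ℝ) : c * Real.sin (Real.pi - Real.pi / 6) = c / 2 ∧
    c * Real.cos (Real.pi - Real.pi / 6) = -(√3 / 2 * c) := by
  rw [Real.sin_pi_sub, Real.cos_pi_sub, Real.sin_pi_div_six, Real.cos_pi_div_six]
  constructor <;> ring

theorem angle_self {c γ m κ : ℝ} (hs : c * Real.sin γ = m) (hk : c * Real.cos γ = κ) :
    c * Real.sin (γ - Real.pi / 6) = √3 / 2 * m - κ / 2 ∧
    c * Real.cos (γ - Real.pi / 6) = √3 / 2 * κ + m / 2 := by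
  rw [Real.sin_sub, Real.cos_sub, Real.sin_pi_div_six, Real.cos_pi_div_six, ← hs, ← hk]
  constructor <;> ring

theorem angle_sub_third {c γ m κ : ℝ} (hs : c * Real.sin γ = m) (hk : c * Real.cos γ = κ) :
    c * Real.sin (γ - Real.pi / 3 - Real.pi / 6) = -κ ∧
    c * Real.cos (γ - Real.pi / 3 - Real.pi / 6) = m := by
  rw [show γ - Real.pi / 3 - Real.pi / 6 = γ - Real.pi / 2 by ring, Real.sin_sub_pi_div_two,
    Real.cos_sub_pi_div_two, ← hs, ← hk]
  constructor <;> ring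

theorem angle_two_thirds_sub {c γ m κ : ℝ} (hs : c * Real.sin γ = m) (hk : c * Real.cos γ = κ) :
    c * Real.sin (2 * Real.pi / 3 - γ - Real.pi / 6) = κ ∧
    c * Real.cos (2 * Real.pi / 3 - γ - Real.pi / 6) = m := by
  rw [show 2 * Real.pi / 3 - γ - Real.pi / 6 = Real.pi / 2 - γ by ring, Real.sin_pi_div_two_sub,
    Real.cos_pi_div_two_sub]
  exact ⟨hk, hs⟩

theorem angle_two_thirds_add {c γ m κ : ℝ} (hs : c * Real.sin γ = m) (hk : c * Real.cos γ = κ) :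
    c * Real.sin (2 * Real.pi / 3 + γ - Real.pi / 6) = κ ∧
    c * Real.cos (2 * Real.pi / 3 + γ - Real.pi / 6) = -m := by
  rw [show 2 * Real.pi / 3 + γ - Real.pi / 6 = γ + Real.pi / 2 by ring, Real.sin_add_pi_div_two,
    Real.cos_add_pi_div_two, ← hs, ← hk]
  constructor <;> ring

theorem angle_pi_sub {c γ m κ : ℝ} (hs : c * Real.sin γ = m) (hk : c * Real.cos γ = κ) :
    c * Real.sin (Real.pi - γ - Real.pi / 6) = √3 / 2 * m + κ / 2 ∧
    c * Real.cos (Real.pi - γ - Real.pi / 6) = m / 2 - √3 / 2 * κ := by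
  rw [show Real.pi - γ - Real.pi / 6 = Real.pi - (γ + Real.pi / 6) by ring, Real.sin_pi_sub,
    Real.cos_pi_sub, Real.sin_add, Real.cos_add, Real.sin_pi_div_six, Real.cos_pi_div_six,
    ← hs, ← hk]
  constructor <;> ring

theorem sq_add_sq_of_mul_sin_of_mul_cos {c γ m κ : ℝ} (hs : c * Real.sin γ = m)
    (hk : c * Real.cos γ = κ) : κ ^ 2 + m ^ 2 = c ^ 2 := by
  rw [← hs, ← hk]
  linear_combination c ^ 2 * Real.sin_sq_add_cos_sq γ

theorem hasIntervalIntegral_angularDensity_le_one {c : ℝ} (hc : 0 < c) (hc1 : c ≤ 1) :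
    HasIntervalIntegral (angularDensity c) 0 Real.pi
      (c - Real.pi / 12 * c ^ 2 - √3 / 8 * c ^ 2) := by
  have hp := Real.pi_pos
  have h0 : c * Real.sin 0 = 0 := by simp
  have hw : ∀ θ, θ ∈ Ioo 0 Real.pi → c * Real.sin θ ≤ 1 := fun θ _ =>
    (mul_le_of_le_one_right hc.le (Real.sin_le_one θ)).trans hc1
  have hq : ∀ x, c * Real.cos x ≤ 1 := fun x =>
    (mul_le_of_le_one_right hc.le (Real.cos_le_one x)).trans hc1
  have hq' : ∀ x, -1 ≤ c * Real.cos x := fun x => by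
    have := mul_le_mul_of_nonneg_left (Real.neg_one_le_cos x) hc.le
    linarith
  have p1 := hasIntervalIntegral_angularDensity 0 1 (-1 / 2) (c := c) (a := 0)
    (b := 2 * Real.pi / 3) (by linarith) (fun θ hθ => by
      have q0 := lt_mul_cos (x := θ - Real.pi / 6) hc h0 (by linarith) (by linarith [hθ.1])
        (by linarith [hθ.2])
      rw [angularDensity, if_pos (hw θ ⟨hθ.1, by linarith [hθ.2]⟩),
        tentPrimitive_of_mem_Icc q0.le (hq _)]
      ring)
  have p2 := hasIntervalIntegral_angularDensity 0 1 (1 / 2) (c := c) (a := 2 * Real.pi / 3)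
    (b := Real.pi) (by linarith) (fun θ hθ => by
      have q0 := mul_cos_lt (x := θ - Real.pi / 6) hc h0 (by linarith) (by linarith [hθ.1])
        (by linarith [hθ.2])
      rw [angularDensity, if_pos (hw θ ⟨by linarith [hθ.1], hθ.2⟩),
        tentPrimitive_of_mem_Icc_neg q0.le (hq' _)]
      ring)
  have h := p1.trans p2
  rw [(angle_zero c).1, (angle_zero c).2, (angle_two_thirds c).1, (angle_two_thirds c).2,
    (angle_pi c).1, (angle_pi c).2] at h
  convert h using 1
  ring

theorem hasIntervalIntegral_angularDensity_of_pi_div_three_le {c α κ : ℝ} (hc : 0 < c) (ha : c * Real.sin α = 1)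
    (hκ : c * Real.cos α = κ)
    (hα : Real.pi / 3 ≤ α) (hα' : α < Real.pi / 2) (hc2 : c ≤ 2) :
    HasIntervalIntegral (angularDensity c) 0 Real.pi
      (-(c ^ 2 / 2 + 2) * α + Real.pi / 6 * c ^ 2 - √3 / 8 * c ^ 2 + c - 5 / 2 * κ + Real.pi) := by
  have hp := Real.pi_pos
  have h0 : c * Real.sin 0 = 0 := by simp
  have ha' : c * Real.sin (-α) = -1 := by rw [Real.sin_neg]; linarith
  have p1 := hasIntervalIntegral_angularDensity 0 1 (-1 / 2) (c := c) (a := 0)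
    (b := α - Real.pi / 3) (by linarith) (fun θ hθ => by
      obtain ⟨h1, h2⟩ := hθ
      have w := mul_sin_lt (x := θ) hc ha (by linarith) (by linarith) (by linarith)
      have q := lt_mul_cos (x := θ - Real.pi / 6) hc h0 (by linarith) (by linarith) (by linarith)
      have q' := mul_cos_lt_of_neg (x := θ - Real.pi / 6) hc ha (by linarith) (by linarith) (by linarith)
      rw [angularDensity_eq_of_le_one w,
        tentPrimitive_of_mem_Icc q.le q'.le]
      ring)
  have p2 := hasIntervalIntegral_angularDensity (1 / 2) 0 0 (c := c) (a := α - Real.pi / 3)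
    (b := 2 * Real.pi / 3 - α) (by linarith) (fun θ hθ => by
      obtain ⟨h1, h2⟩ := hθ
      have w := mul_sin_lt (x := θ) hc ha (by linarith) (by linarith) (by linarith)
      have q := lt_mul_cos (x := θ - Real.pi / 6) hc ha (by linarith) (by linarith) (by linarith)
      rw [angularDensity_eq_of_le_one w,
        tentPrimitive_of_one_le q.le]
      ring)
  have p3 := hasIntervalIntegral_angularDensity 0 1 (-1 / 2) (c := c) (a := 2 * Real.pi / 3 - α)
    (b := α) (by linarith) (fun θ hθ => by
      obtain ⟨h1, h2⟩ := hθ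
      have w := mul_sin_lt (x := θ) hc ha (by linarith) (by linarith) (by linarith)
      have q := lt_mul_cos (x := θ - Real.pi / 6) hc h0 (by linarith) (by linarith) (by linarith)
      have q' := mul_cos_lt (x := θ - Real.pi / 6) hc ha (by linarith) (by linarith) (by linarith)
      rw [angularDensity_eq_of_le_one w,
        tentPrimitive_of_mem_Icc q.le q'.le]
      ring)
  have p4 := hasIntervalIntegral_angularDensity (1 / 2) 0 (-1 / 2) (c := c) (a := α)
    (b := Real.pi - α) (by linarith) (fun θ hθ => by
      obtain ⟨h1, h2⟩ := hθ
      have w := lt_mul_sin (x := θ) hc ha (by linarith) (by linarith) (by linarith)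
      have w' := mul_le_of_le_one_right hc.le (Real.sin_le_one θ)
      have q := lt_mul_cos (x := θ - Real.pi / 6) hc h0 (by linarith) (by linarith) (by linarith)
      have q' := mul_cos_lt (x := θ - Real.pi / 6) hc ha (by linarith) (by linarith) (by linarith)
      rw [angularDensity_eq_of_le_two w (w'.trans hc2),
        tentPrimitive_of_mem_Icc (by linarith) (by linarith)]
      ring)
  have p5 := hasIntervalIntegral_angularDensity 0 1 (-1 / 2) (c := c) (a := Real.pi - α)
    (b := 2 * Real.pi / 3) (by linarith) (fun θ hθ => by
      obtain ⟨h1, h2⟩ := hθ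
      have w := mul_sin_lt_of_sub_lt (x := θ) hc ha (by linarith) (by linarith) (by linarith)
      have q := lt_mul_cos (x := θ - Real.pi / 6) hc h0 (by linarith) (by linarith) (by linarith)
      have q' := mul_cos_lt (x := θ - Real.pi / 6) hc ha (by linarith) (by linarith) (by linarith)
      rw [angularDensity_eq_of_le_one w,
        tentPrimitive_of_mem_Icc q.le q'.le]
      ring)
  have p6 := hasIntervalIntegral_angularDensity 0 1 (1 / 2) (c := c) (a := 2 * Real.pi / 3)
    (b := Real.pi) (by linarith) (fun θ hθ => by
      obtain ⟨h1, h2⟩ := hθ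
      have w := mul_sin_lt_of_sub_lt (x := θ) hc ha (by linarith) (by linarith) (by linarith)
      have q := mul_cos_lt (x := θ - Real.pi / 6) hc h0 (by linarith) (by linarith) (by linarith)
      have q' := lt_mul_cos (x := θ - Real.pi / 6) hc ha' (by linarith) (by linarith) (by linarith)
      rw [angularDensity_eq_of_le_one w,
        tentPrimitive_of_mem_Icc_neg q.le q'.le]
      ring)
  have h := (((((p1).trans p2).trans p3).trans p4).trans p5).trans p6
  rw [(angle_zero c).1, (angle_zero c).2,
    (angle_sub_third ha hκ).1, (angle_sub_third ha hκ).2,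
    (angle_two_thirds_sub ha hκ).1, (angle_two_thirds_sub ha hκ).2,
    (angle_self ha hκ).1, (angle_self ha hκ).2,
    (angle_pi_sub ha hκ).1, (angle_pi_sub ha hκ).2,
    (angle_two_thirds c).1, (angle_two_thirds c).2,
    (angle_pi c).1, (angle_pi c).2] at h
  convert h using 1
  ring

theorem hasIntervalIntegral_angularDensity_of_pi_div_six_le {c α κ : ℝ} (hc : 0 < c) (ha : c * Real.sin α = 1)
    (hκ : c * Real.cos α = κ)
    (hα : Real.pi / 6 ≤ α) (hα' : α < Real.pi / 3) (hc2 : c ≤ 2) :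
    HasIntervalIntegral (angularDensity c) 0 Real.pi
      (-(c ^ 2 / 4 + 2) * α + Real.pi / 12 * c ^ 2 + √3 / 8 * c ^ 2 - 9 / 4 * κ + Real.pi + √3 / 4) := by
  have hp := Real.pi_pos
  have h0 : c * Real.sin 0 = 0 := by simp
  have ha' : c * Real.sin (-α) = -1 := by rw [Real.sin_neg]; linarith
  have p1 := hasIntervalIntegral_angularDensity (1 / 2) 0 0 (c := c) (a := 0)
    (b := α) (by linarith) (fun θ hθ => by
      obtain ⟨h1, h2⟩ := hθ
      have w := mul_sin_lt (x := θ) hc ha (by linarith) (by linarith) (by linarith)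
      have q := lt_mul_cos (x := θ - Real.pi / 6) hc ha (by linarith) (by linarith) (by linarith)
      rw [angularDensity_eq_of_le_one w,
        tentPrimitive_of_one_le q.le]
      ring)
  have p2 := hasIntervalIntegral_angularDensity (3 / 2) (-2) (1 / 2) (c := c) (a := α)
    (b := 2 * Real.pi / 3 - α) (by linarith) (fun θ hθ => by
      obtain ⟨h1, h2⟩ := hθ
      have w := lt_mul_sin (x := θ) hc ha (by linarith) (by linarith) (by linarith)
      have w' := mul_le_of_le_one_right hc.le (Real.sin_le_one θ)
      have q := lt_mul_cos (x := θ - Real.pi / 6) hc ha (by linarith) (by linarith) (by linarith)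
      have q' := mul_le_of_le_one_right hc.le (Real.cos_le_one (θ - Real.pi / 6))
      rw [angularDensity_eq_of_le_two w (w'.trans hc2),
        tentPrimitive_of_mem_Icc_neg (by linarith) (by linarith)]
      ring)
  have p3 := hasIntervalIntegral_angularDensity (1 / 2) 0 (-1 / 2) (c := c) (a := 2 * Real.pi / 3 - α)
    (b := 2 * Real.pi / 3) (by linarith) (fun θ hθ => by
      obtain ⟨h1, h2⟩ := hθ
      have w := lt_mul_sin (x := θ) hc ha (by linarith) (by linarith) (by linarith)
      have w' := mul_le_of_le_one_right hc.le (Real.sin_le_one θ)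
      have q := lt_mul_cos (x := θ - Real.pi / 6) hc h0 (by linarith) (by linarith) (by linarith)
      have q' := mul_cos_lt (x := θ - Real.pi / 6) hc ha (by linarith) (by linarith) (by linarith)
      rw [angularDensity_eq_of_le_two w (w'.trans hc2),
        tentPrimitive_of_mem_Icc (by linarith) (by linarith)]
      ring)
  have p4 := hasIntervalIntegral_angularDensity (1 / 2) 0 0 (c := c) (a := 2 * Real.pi / 3)
    (b := Real.pi - α) (by linarith) (fun θ hθ => by
      obtain ⟨h1, h2⟩ := hθ
      have w := lt_mul_sin (x := θ) hc ha (by linarith) (by linarith) (by linarith)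
      have w' := mul_le_of_le_one_right hc.le (Real.sin_le_one θ)
      have q := mul_cos_lt (x := θ - Real.pi / 6) hc h0 (by linarith) (by linarith) (by linarith)
      rw [angularDensity_eq_of_le_two w (w'.trans hc2),
        tentPrimitive_of_one_le (by linarith)]
      ring)
  have p5 := hasIntervalIntegral_angularDensity 0 1 (1 / 2) (c := c) (a := Real.pi - α)
    (b := 2 * Real.pi / 3 + α) (by linarith) (fun θ hθ => by
      obtain ⟨h1, h2⟩ := hθ
      have w := mul_sin_lt_of_sub_lt (x := θ) hc ha (by linarith) (by linarith) (by linarith)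
      have q := mul_cos_lt (x := θ - Real.pi / 6) hc h0 (by linarith) (by linarith) (by linarith)
      have q' := lt_mul_cos (x := θ - Real.pi / 6) hc ha' (by linarith) (by linarith) (by linarith)
      rw [angularDensity_eq_of_le_one w,
        tentPrimitive_of_mem_Icc_neg q.le q'.le]
      ring)
  have p6 := hasIntervalIntegral_angularDensity (-1 / 2) 0 0 (c := c) (a := 2 * Real.pi / 3 + α)
    (b := Real.pi) (by linarith) (fun θ hθ => by
      obtain ⟨h1, h2⟩ := hθ
      have w := mul_sin_lt_of_sub_lt (x := θ) hc ha (by linarith) (by linarith) (by linarith)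
      have q := mul_cos_lt (x := θ - Real.pi / 6) hc ha' (by linarith) (by linarith) (by linarith)
      rw [angularDensity_eq_of_le_one w,
        tentPrimitive_of_le_neg_one q.le]
      ring)
  have h := (((((p1).trans p2).trans p3).trans p4).trans p5).trans p6
  rw [(angle_zero c).1, (angle_zero c).2,
    (angle_self ha hκ).1, (angle_self ha hκ).2,
    (angle_two_thirds_sub ha hκ).1, (angle_two_thirds_sub ha hκ).2,
    (angle_two_thirds c).1, (angle_two_thirds c).2,
    (angle_pi_sub ha hκ).1, (angle_pi_sub ha hκ).2,
    (angle_two_thirds_add ha hκ).1, (angle_two_thirds_add ha hκ).2,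
    (angle_pi c).1, (angle_pi c).2] at h
  convert h using 1
  linear_combination (-√3 / 8) * sq_add_sq_of_mul_sin_of_mul_cos ha hκ

theorem hasIntervalIntegral_angularDensity_of_pi_div_three_le_of_two {c α κ β l : ℝ} (hc : 0 < c) (ha : c * Real.sin α = 1)
    (hκ : c * Real.cos α = κ) (hb : c * Real.sin β = 2) (hl : c * Real.cos β = l)
    (hα0 : 0 < α) (hα : α < Real.pi / 6) (hβ : Real.pi / 3 ≤ β) (hβ' : β < Real.pi / 2)
    (hαβ : β ≤ α + Real.pi / 3) :
    HasIntervalIntegral (angularDensity c) 0 Real.pi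
      ((c ^ 2 / 4 + 4) * β - Real.pi / 12 * c ^ 2 - √3 / 8 * c ^ 2 + 5 / 2 * l - 4 * Real.pi / 3 - √3) := by
  have hp := Real.pi_pos
  have h0 : c * Real.sin 0 = 0 := by simp
  have ha' : c * Real.sin (-α) = -1 := by rw [Real.sin_neg]; linarith
  have p1 := hasIntervalIntegral_angularDensity (1 / 2) 0 0 (c := c) (a := 0)
    (b := α) (by linarith) (fun θ hθ => by
      obtain ⟨h1, h2⟩ := hθ
      have w := mul_sin_lt (x := θ) hc ha (by linarith) (by linarith) (by linarith)
      have q := lt_mul_cos (x := θ - Real.pi / 6) hc ha (by linarith) (by linarith) (by linarith)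
      rw [angularDensity_eq_of_le_one w,
        tentPrimitive_of_one_le q.le]
      ring)
  have p2 := hasIntervalIntegral_angularDensity (-1 / 2) 0 0 (c := c) (a := α)
    (b := 2 * Real.pi / 3 - β) (by linarith) (fun θ hθ => by
      obtain ⟨h1, h2⟩ := hθ
      have w := lt_mul_sin (x := θ) hc ha (by linarith) (by linarith) (by linarith)
      have w' := mul_sin_lt (x := θ) hc hb (by linarith) (by linarith) (by linarith)
      have q := lt_mul_cos (x := θ - Real.pi / 6) hc hb (by linarith) (by linarith) (by linarith)
      rw [angularDensity_eq_of_le_two w w'.le,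
        tentPrimitive_of_le_neg_one (by linarith)]
      ring)
  have p3 := hasIntervalIntegral_angularDensity (3 / 2) (-2) (1 / 2) (c := c) (a := 2 * Real.pi / 3 - β)
    (b := β) (by linarith) (fun θ hθ => by
      obtain ⟨h1, h2⟩ := hθ
      have w := lt_mul_sin (x := θ) hc ha (by linarith) (by linarith) (by linarith)
      have w' := mul_sin_lt (x := θ) hc hb (by linarith) (by linarith) (by linarith)
      have q := lt_mul_cos (x := θ - Real.pi / 6) hc ha (by linarith) (by linarith) (by linarith)
      have q' := mul_cos_lt (x := θ - Real.pi / 6) hc hb (by linarith) (by linarith) (by linarith)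
      rw [angularDensity_eq_of_le_two w w'.le,
        tentPrimitive_of_mem_Icc_neg (by linarith) (by linarith)]
      ring)
  have p4 := hasIntervalIntegral_angularDensity 0 0 0 (c := c) (a := β)
    (b := Real.pi - β) (by linarith) (fun θ hθ => by
      obtain ⟨h1, h2⟩ := hθ
      have w' := lt_mul_sin (x := θ) hc hb (by linarith) (by linarith) (by linarith)
      rw [angularDensity_eq_zero w']
      ring)
  have p5 := hasIntervalIntegral_angularDensity (1 / 2) 0 (-1 / 2) (c := c) (a := Real.pi - β)
    (b := 2 * Real.pi / 3) (by linarith) (fun θ hθ => by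
      obtain ⟨h1, h2⟩ := hθ
      have w := lt_mul_sin (x := θ) hc ha (by linarith) (by linarith) (by linarith)
      have w' := mul_sin_lt_of_sub_lt (x := θ) hc hb (by linarith) (by linarith) (by linarith)
      have q := lt_mul_cos (x := θ - Real.pi / 6) hc h0 (by linarith) (by linarith) (by linarith)
      have q' := mul_cos_lt (x := θ - Real.pi / 6) hc ha (by linarith) (by linarith) (by linarith)
      rw [angularDensity_eq_of_le_two w w'.le,
        tentPrimitive_of_mem_Icc (by linarith) (by linarith)]
      ring)
  have p6 := hasIntervalIntegral_angularDensity (1 / 2) 0 0 (c := c) (a := 2 * Real.pi / 3)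
    (b := Real.pi - α) (by linarith) (fun θ hθ => by
      obtain ⟨h1, h2⟩ := hθ
      have w := lt_mul_sin (x := θ) hc ha (by linarith) (by linarith) (by linarith)
      have w' := mul_sin_lt_of_sub_lt (x := θ) hc hb (by linarith) (by linarith) (by linarith)
      have q := mul_cos_lt (x := θ - Real.pi / 6) hc h0 (by linarith) (by linarith) (by linarith)
      rw [angularDensity_eq_of_le_two w w'.le,
        tentPrimitive_of_one_le (by linarith)]
      ring)
  have p7 := hasIntervalIntegral_angularDensity (-1 / 2) 0 0 (c := c) (a := Real.pi - α)
    (b := Real.pi) (by linarith) (fun θ hθ => by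
      obtain ⟨h1, h2⟩ := hθ
      have w := mul_sin_lt_of_sub_lt (x := θ) hc ha (by linarith) (by linarith) (by linarith)
      have q := mul_cos_lt (x := θ - Real.pi / 6) hc ha' (by linarith) (by linarith) (by linarith)
      rw [angularDensity_eq_of_le_one w,
        tentPrimitive_of_le_neg_one q.le]
      ring)
  have h := ((((((p1).trans p2).trans p3).trans p4).trans p5).trans p6).trans p7
  rw [(angle_zero c).1, (angle_zero c).2,
    (angle_self ha hκ).1, (angle_self ha hκ).2,
    (angle_two_thirds_sub hb hl).1, (angle_two_thirds_sub hb hl).2,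
    (angle_self hb hl).1, (angle_self hb hl).2,
    (angle_pi_sub hb hl).1, (angle_pi_sub hb hl).2,
    (angle_two_thirds c).1, (angle_two_thirds c).2,
    (angle_pi_sub ha hκ).1, (angle_pi_sub ha hκ).2,
    (angle_pi c).1, (angle_pi c).2] at h
  convert h using 1
  linear_combination (√3 / 8) * sq_add_sq_of_mul_sin_of_mul_cos hb hl

theorem hasIntervalIntegral_angularDensity_of_lt_pi_div_three {c α κ β l : ℝ} (hc : 0 < c) (ha : c * Real.sin α = 1)
    (hκ : c * Real.cos α = κ) (hb : c * Real.sin β = 2) (hl : c * Real.cos β = l)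
    (hα0 : 0 < α) (hαβ : α < β) (hβ : β < Real.pi / 3) 
    (hα : α ≤ Real.pi / 6) :
    HasIntervalIntegral (angularDensity c) 0 Real.pi
      (0) := by
  have hp := Real.pi_pos
  have h0 : c * Real.sin 0 = 0 := by simp
  have ha' : c * Real.sin (-α) = -1 := by rw [Real.sin_neg]; linarith
  have p1 := hasIntervalIntegral_angularDensity (1 / 2) 0 0 (c := c) (a := 0)
    (b := α) (by linarith) (fun θ hθ => by
      obtain ⟨h1, h2⟩ := hθ
      have w := mul_sin_lt (x := θ) hc ha (by linarith) (by linarith) (by linarith)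
      have q := lt_mul_cos (x := θ - Real.pi / 6) hc ha (by linarith) (by linarith) (by linarith)
      rw [angularDensity_eq_of_le_one w,
        tentPrimitive_of_one_le q.le]
      ring)
  have p2 := hasIntervalIntegral_angularDensity (-1 / 2) 0 0 (c := c) (a := α)
    (b := β) (by linarith) (fun θ hθ => by
      obtain ⟨h1, h2⟩ := hθ
      have w := lt_mul_sin (x := θ) hc ha (by linarith) (by linarith) (by linarith)
      have w' := mul_sin_lt (x := θ) hc hb (by linarith) (by linarith) (by linarith)
      have q := lt_mul_cos (x := θ - Real.pi / 6) hc hb (by linarith) (by linarith) (by linarith)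
      rw [angularDensity_eq_of_le_two w w'.le,
        tentPrimitive_of_le_neg_one (by linarith)]
      ring)
  have p3 := hasIntervalIntegral_angularDensity 0 0 0 (c := c) (a := β)
    (b := Real.pi - β) (by linarith) (fun θ hθ => by
      obtain ⟨h1, h2⟩ := hθ
      have w' := lt_mul_sin (x := θ) hc hb (by linarith) (by linarith) (by linarith)
      rw [angularDensity_eq_zero w']
      ring)
  have p4 := hasIntervalIntegral_angularDensity (1 / 2) 0 0 (c := c) (a := Real.pi - β)
    (b := Real.pi - α) (by linarith) (fun θ hθ => by
      obtain ⟨h1, h2⟩ := hθ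
      have w := lt_mul_sin (x := θ) hc ha (by linarith) (by linarith) (by linarith)
      have w' := mul_sin_lt_of_sub_lt (x := θ) hc hb (by linarith) (by linarith) (by linarith)
      have q := mul_cos_lt (x := θ - Real.pi / 6) hc h0 (by linarith) (by linarith) (by linarith)
      rw [angularDensity_eq_of_le_two w w'.le,
        tentPrimitive_of_one_le (by linarith)]
      ring)
  have p5 := hasIntervalIntegral_angularDensity (-1 / 2) 0 0 (c := c) (a := Real.pi - α)
    (b := Real.pi) (by linarith) (fun θ hθ => by
      obtain ⟨h1, h2⟩ := hθ
      have w := mul_sin_lt_of_sub_lt (x := θ) hc ha (by linarith) (by linarith) (by linarith)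
      have q := mul_cos_lt (x := θ - Real.pi / 6) hc ha' (by linarith) (by linarith) (by linarith)
      rw [angularDensity_eq_of_le_one w,
        tentPrimitive_of_le_neg_one q.le]
      ring)
  have h := ((((p1).trans p2).trans p3).trans p4).trans p5
  rw [(angle_zero c).1, (angle_zero c).2,
    (angle_self ha hκ).1, (angle_self ha hκ).2,
    (angle_self hb hl).1, (angle_self hb hl).2,
    (angle_pi_sub hb hl).1, (angle_pi_sub hb hl).2,
    (angle_pi_sub ha hκ).1, (angle_pi_sub ha hκ).2,
    (angle_pi c).1, (angle_pi c).2] at h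
  convert h using 1
  ring

theorem mul_sin_arcsin_div {c m : ℝ} (hm : 0 ≤ m) (hmc : m ≤ c) (hc : 0 < c) :
    c * Real.sin (Real.arcsin (m / c)) = m := by
  rw [Real.sin_arcsin (by have : 0 ≤ m / c := by positivity
                          linarith) ((div_le_one hc).2 hmc)]
  field_simp

theorem sqrt_three_mul_sq_sub {c γ m : ℝ} (hc : 0 < c) (hs : c * Real.sin γ = m)
    (hγ : -(Real.pi / 2) ≤ γ) (hγ' : γ ≤ Real.pi / 2) {a : ℝ} (ha : a = 3 * (c ^ 2 - m ^ 2)) :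
    √a = √3 * (c * Real.cos γ) := by
  have h := sq_add_sq_of_mul_sin_of_mul_cos hs rfl
  have hk : 0 ≤ c * Real.cos γ := mul_nonneg hc.le (Real.cos_nonneg_of_neg_pi_div_two_le_of_le hγ hγ')
  rw [show a = 3 * (c * Real.cos γ) ^ 2 by rw [ha]; linarith, Real.sqrt_mul (by norm_num),
    Real.sqrt_sq hk]

theorem hasIntervalIntegral_angularDensity_rhombusEdgeDensity {c : ℝ} (hc : 0 < c) :
    HasIntervalIntegral (angularDensity c) 0 Real.pi
      (rhombusEdgeDensity (√3 / 2 * c) / (2 * c)) := by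
  have h3 : √3 ^ 2 = 3 := Real.sq_sqrt (by norm_num)
  have h30 : 0 < √3 := by positivity
  have hp := Real.pi_pos
  have hr0 : ¬ √3 / 2 * c < 0 := not_lt.2 (by positivity)
  have e1 : √3 / (2 * (√3 / 2 * c)) = 1 / c := by field_simp
  have e2 : √3 / (√3 / 2 * c) = 2 / c := by field_simp
  have sq : (√3 / 2 * c) ^ 2 = 3 / 4 * c ^ 2 := by rw [mul_pow, div_pow, h3]; ring
  rw [rhombusEdgeDensity, if_neg hr0, e1, e2]
  by_cases h1 : c ≤ 1
  · rw [if_pos (by nlinarith)]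
    convert hasIntervalIntegral_angularDensity_le_one hc h1 using 1
    rw [sq]
    field_simp
    grind
  push Not at h1
  have ha := mul_sin_arcsin_div zero_le_one h1.le hc
  have hα' : Real.arcsin (1 / c) < Real.pi / 2 :=
    Real.arcsin_lt_pi_div_two.2 ((div_lt_one hc).2 h1)
  have hα0 : 0 < Real.arcsin (1 / c) := Real.arcsin_pos.2 (by positivity)
  have s1 := sqrt_three_mul_sq_sub (a := 4 * (√3 / 2 * c) ^ 2 - 3) hc ha (by linarith) hα'.le
    (by rw [sq]; ring)
  rw [if_neg (by nlinarith : ¬ √3 / 2 * c ≤ √3 / 2), s1]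
  by_cases h2 : √3 / 2 * c ≤ 1
  · have hα : Real.pi / 3 ≤ Real.arcsin (1 / c) := by
      rw [Real.le_arcsin_iff_sin_le' ⟨by linarith, by linarith⟩, Real.sin_pi_div_three,
        le_div_iff₀ hc]
      exact h2
    rw [if_pos h2]
    convert hasIntervalIntegral_angularDensity_of_pi_div_three_le hc ha rfl hα hα'
      (by nlinarith) using 1
    rw [sq]
    field_simp
    grind
  rw [if_neg h2]
  push Not at h2
  have hα3 : Real.arcsin (1 / c) < Real.pi / 3 := by
    rw [Real.arcsin_lt_iff_lt_sin' ⟨by linarith, by linarith⟩, Real.sin_pi_div_three,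
        div_lt_iff₀ hc]
    exact h2
  by_cases hc2 : c ≤ 2
  · have hα : Real.pi / 6 ≤ Real.arcsin (1 / c) := by
      rw [Real.le_arcsin_iff_sin_le' ⟨by linarith, by linarith⟩, Real.sin_pi_div_six,
        le_div_iff₀ hc]
      linarith
    rw [if_pos (by nlinarith)]
    convert hasIntervalIntegral_angularDensity_of_pi_div_six_le hc ha rfl hα hα3 hc2 using 1
    rw [sq]
    field_simp
    grind
  rw [if_neg (by nlinarith : ¬ √3 / 2 * c ≤ √3)]
  push Not at hc2
  have hα6 : Real.arcsin (1 / c) < Real.pi / 6 := by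
    rw [Real.arcsin_lt_iff_lt_sin' ⟨by linarith, by linarith⟩, Real.sin_pi_div_six,
        div_lt_iff₀ hc]
    linarith
  have hb := mul_sin_arcsin_div zero_le_two hc2.le hc
  have hβ' : Real.arcsin (2 / c) < Real.pi / 2 :=
    Real.arcsin_lt_pi_div_two.2 ((div_lt_one hc).2 hc2)
  have hβ0 : 0 < Real.arcsin (2 / c) := Real.arcsin_pos.2 (by positivity)
  have s2 : √((√3 / 2 * c) ^ 2 - 3) = √3 * (c * Real.cos (Real.arcsin (2 / c))) / 2 := by
    have h := sqrt_three_mul_sq_sub (a := 2 ^ 2 * ((√3 / 2 * c) ^ 2 - 3)) hc hb (by linarith) hβ'.le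
      (by rw [sq]; ring)
    rw [Real.sqrt_mul (by norm_num), Real.sqrt_sq (by norm_num)] at h
    linarith
  by_cases h4 : √3 / 2 * c ≤ 2
  · rw [if_pos h4, s2]
    have hβ : Real.pi / 3 ≤ Real.arcsin (2 / c) := by
      rw [Real.le_arcsin_iff_sin_le' ⟨by linarith, by linarith⟩, Real.sin_pi_div_three,
        le_div_iff₀ hc]
      exact h4
    have hαβ : Real.arcsin (2 / c) ≤ Real.arcsin (1 / c) + Real.pi / 3 := by
      have hk := sq_add_sq_of_mul_sin_of_mul_cos ha rfl
      have hκ : √3 ≤ c * Real.cos (Real.arcsin (1 / c)) := by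
        refine Real.sqrt_le_iff.2 ⟨mul_nonneg hc.le
          (Real.cos_nonneg_of_neg_pi_div_two_le_of_le (by linarith) hα'.le), ?_⟩
        nlinarith
      rw [Real.arcsin_le_iff_le_sin' ⟨by linarith, by linarith⟩, Real.sin_add,
        Real.cos_pi_div_three, Real.sin_pi_div_three, div_le_iff₀ hc]
      nlinarith
    convert hasIntervalIntegral_angularDensity_of_pi_div_three_le_of_two hc ha rfl hb rfl hα0 hα6
      hβ hβ' hαβ using 1
    rw [sq]
    field_simp
    grind
  · rw [if_neg h4]
    push Not at h4
    have hβ : Real.arcsin (2 / c) < Real.pi / 3 := by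
      rw [Real.arcsin_lt_iff_lt_sin' ⟨by linarith, by linarith⟩, Real.sin_pi_div_three,
        div_lt_iff₀ hc]
      exact h4
    convert hasIntervalIntegral_angularDensity_of_lt_pi_div_three hc ha rfl hb rfl hα0
      (Real.arcsin_lt_arcsin (by have : 0 < 1 / c := by positivity
                                 linarith) (by gcongr; norm_num) ((div_le_one hc).2 hc2.le))
      hβ hα6.le using 1
    simp

theorem lintegral_indicator_Icc_mul_indicator_Icc (x : ℝ) :
    ∫⁻ s in Icc (0 : ℝ) 1, (Icc (0 : ℝ) 1).indicator 1 (x + s) = ENNReal.ofReal (tent x) := by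
  have h : ∀ s, (Icc (0 : ℝ) 1).indicator (1 : ℝ → ℝ≥0∞) (x + s)
      = (Icc (-x) (1 - x)).indicator 1 s := by
    intro s
    simp only [indicator, mem_Icc, Pi.one_apply]
    congr 1
    apply propext
    constructor <;> rintro ⟨h1, h2⟩ <;> constructor <;> linarith
  simp_rw [h]
  rw [lintegral_indicator_one measurableSet_Icc, Measure.restrict_apply measurableSet_Icc,
    Icc_inter_Icc, Real.volume_Icc, tent]
  rcases le_total 0 x with hx | hx
  · rw [abs_of_nonneg hx, max_eq_right (by linarith), min_eq_left (by linarith)]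
    rw [ENNReal.ofReal_max, ENNReal.ofReal_zero, max_eq_right zero_le]
    simp
  · rw [abs_of_nonpos hx, max_eq_left (by linarith), min_eq_right (by linarith)]
    rw [ENNReal.ofReal_max, ENNReal.ofReal_zero, max_eq_right zero_le]

theorem lintegral_sub_unitInterval {G : ℝ → ℝ≥0∞} (hG : Measurable G) :
    ∫⁻ s in Icc (0 : ℝ) 1, ∫⁻ s' in Icc (0 : ℝ) 1, G (s - s')
      = ∫⁻ x, G x * ENNReal.ofReal (tent x) := by
  have hI : Measurable ((Icc (0 : ℝ) 1).indicator (1 : ℝ → ℝ≥0∞)) :=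
    measurable_one.indicator measurableSet_Icc
  calc ∫⁻ s in Icc (0 : ℝ) 1, ∫⁻ s' in Icc (0 : ℝ) 1, G (s - s')
      = ∫⁻ s' in Icc (0 : ℝ) 1, ∫⁻ s in Icc (0 : ℝ) 1, G (s - s') :=
        lintegral_lintegral_swap (by fun_prop)
    _ = ∫⁻ s' in Icc (0 : ℝ) 1, ∫⁻ x, (Icc (0 : ℝ) 1).indicator 1 (x + s') * G x := by
        congr 1 with s'
        rw [← lintegral_indicator measurableSet_Icc,
          ← lintegral_add_right_eq_self _ s']
        congr 1 with x
        by_cases hx : x + s' ∈ Icc (0 : ℝ) 1 <;> simp [hx, indicator]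
    _ = ∫⁻ x, ∫⁻ s' in Icc (0 : ℝ) 1, (Icc (0 : ℝ) 1).indicator 1 (x + s') * G x :=
        lintegral_lintegral_swap (by fun_prop)
    _ = _ := by
        congr 1 with x
        rw [lintegral_mul_const _ (by fun_prop), lintegral_indicator_Icc_mul_indicator_Icc, mul_comm]

/-- The density of `(s - s' - t', t + t')` for independent uniform `s, t, s', t'` on `[0, 1]`. -/
noncomputable def rhombusDifferenceDensity (a b : ℝ) : ℝ :=
  if 0 ≤ b ∧ b ≤ 2 then tentPrimitive (a + min 1 b) - tentPrimitive (a + max 0 (b - 1)) else 0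

theorem measurable_rhombusDifferenceDensity :
    Measurable fun p : ℝ × ℝ => rhombusDifferenceDensity p.1 p.2 := by
  have := continuous_tentPrimitive.measurable
  unfold rhombusDifferenceDensity
  refine Measurable.ite ?_ (by fun_prop) measurable_const
  exact (measurableSet_le measurable_const measurable_snd).inter
    (measurableSet_le measurable_snd measurable_const)

theorem rhombusDifferenceDensity_nonneg (a b : ℝ) : 0 ≤ rhombusDifferenceDensity a b := by
  unfold rhombusDifferenceDensity
  split_ifs with h
  · refine sub_nonneg.2 (monotone_tentPrimitive ?_)
    have : max 0 (b - 1) ≤ min 1 b :=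
      max_le (le_min zero_le_one h.1) (le_min (by linarith) (by linarith))
    linarith
  · exact le_rfl

theorem lintegral_indicator_mul_tent (a b : ℝ) :
    ∫⁻ t in Icc (0 : ℝ) 1, (Icc (0 : ℝ) 1).indicator 1 (b - t) * ENNReal.ofReal (tent (a + t))
      = ENNReal.ofReal (rhombusDifferenceDensity a b) := by
  have h : ∀ t, (Icc (0 : ℝ) 1).indicator (1 : ℝ → ℝ≥0∞) (b - t) * ENNReal.ofReal (tent (a + t))
      = (Icc (b - 1) b).indicator (fun t => ENNReal.ofReal (tent (a + t))) t := by
    intro t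
    by_cases ht : t ∈ Icc (b - 1) b
    · have : b - t ∈ Icc (0 : ℝ) 1 := ⟨by linarith [ht.2], by linarith [ht.1]⟩
      simp [ht, this, indicator]
    · have : b - t ∉ Icc (0 : ℝ) 1 := fun h => ht ⟨by linarith [h.2], by linarith [h.1]⟩
      rw [indicator_of_notMem ht, indicator_of_notMem this, zero_mul]
  simp_rw [h]
  rw [lintegral_indicator measurableSet_Icc, Measure.restrict_restrict measurableSet_Icc,
    Icc_inter_Icc, rhombusDifferenceDensity]
  change ∫⁻ t in Icc (max (b - 1) 0) (min b 1), _ = _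
  rw [max_comm, min_comm]
  split_ifs with hb
  · have hle : max 0 (b - 1) ≤ min 1 b :=
      max_le (le_min zero_le_one hb.1) (le_min (by linarith) (by linarith))
    rw [tentPrimitive_sub, ← intervalIntegral.integral_comp_add_left,
      intervalIntegral.integral_of_le hle, ← integral_Icc_eq_integral_Ioc,
      ofReal_integral_eq_lintegral_ofReal]
    · exact ((continuous_tent.comp (continuous_const_add a)).integrableOn_Icc)
    · exact Filter.Eventually.of_forall fun t => tent_nonneg _
  · rw [Icc_eq_empty]
    · simp
    · intro hle
      rw [max_le_iff, le_min_iff, le_min_iff] at hle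
      exact hb ⟨hle.1.2, by linarith [hle.2.1]⟩

theorem lintegral_unitSquare_prod_unitSquare {G : ℝ × ℝ → ℝ≥0∞} (hG : Measurable G) :
    ∫⁻ s in Icc (0 : ℝ) 1, ∫⁻ t in Icc (0 : ℝ) 1, ∫⁻ s' in Icc (0 : ℝ) 1, ∫⁻ t' in Icc (0 : ℝ) 1,
        G (s - s' - t', t + t')
      = ∫⁻ a, ∫⁻ b, G (a, b) * ENNReal.ofReal (rhombusDifferenceDensity a b) := by
  have hI : Measurable ((Icc (0 : ℝ) 1).indicator (1 : ℝ → ℝ≥0∞)) :=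
    measurable_one.indicator measurableSet_Icc
  have ht : Measurable tent := continuous_tent.measurable
  calc _ = ∫⁻ s in Icc (0 : ℝ) 1, ∫⁻ s' in Icc (0 : ℝ) 1, ∫⁻ t in Icc (0 : ℝ) 1,
        ∫⁻ t' in Icc (0 : ℝ) 1, G (s - s' - t', t + t') := by
        congr 1 with s
        exact lintegral_lintegral_swap (by fun_prop)
    _ = ∫⁻ x, (∫⁻ t in Icc (0 : ℝ) 1, ∫⁻ t' in Icc (0 : ℝ) 1, G (x - t', t + t'))
          * ENNReal.ofReal (tent x) :=
        lintegral_sub_unitInterval (G := fun x => ∫⁻ t in Icc (0 : ℝ) 1, ∫⁻ t' in Icc (0 : ℝ) 1,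
          G (x - t', t + t')) (by fun_prop)
    _ = ∫⁻ x, ∫⁻ t' in Icc (0 : ℝ) 1, ∫⁻ t in Icc (0 : ℝ) 1,
          G (x - t', t + t') * ENNReal.ofReal (tent x) := by
        congr 1 with x
        rw [lintegral_lintegral_swap (by fun_prop), ← lintegral_mul_const _ (by fun_prop)]
        congr 1 with t'
        rw [lintegral_mul_const _ (by fun_prop)]
    _ = ∫⁻ t' in Icc (0 : ℝ) 1, ∫⁻ x, ∫⁻ t in Icc (0 : ℝ) 1,
          G (x - t', t + t') * ENNReal.ofReal (tent x) := by
        refine lintegral_lintegral_swap (Measurable.aemeasurable ?_)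
        fun_prop
    _ = ∫⁻ t' in Icc (0 : ℝ) 1, ∫⁻ a, ∫⁻ b, G (a, b) *
          ((Icc (0 : ℝ) 1).indicator 1 (b - t') * ENNReal.ofReal (tent (a + t'))) := by
        congr 1 with t'
        rw [← lintegral_add_right_eq_self _ t']
        congr 1 with a
        rw [← lintegral_indicator measurableSet_Icc, ← lintegral_sub_right_eq_self _ t']
        congr 1 with b
        by_cases hb : b - t' ∈ Icc (0 : ℝ) 1
        · simp [hb, indicator]
        · rw [indicator_of_notMem hb, indicator_of_notMem hb]
          simp
    _ = ∫⁻ a, ∫⁻ b, ∫⁻ t' in Icc (0 : ℝ) 1, G (a, b) *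
          ((Icc (0 : ℝ) 1).indicator 1 (b - t') * ENNReal.ofReal (tent (a + t'))) := by
        rw [lintegral_lintegral_swap (Measurable.aemeasurable (by fun_prop))]
        congr 1 with a
        rw [lintegral_lintegral_swap (Measurable.aemeasurable (by fun_prop))]
    _ = _ := by
        congr 1 with a
        congr 1 with b
        rw [lintegral_const_mul _ (by fun_prop), lintegral_indicator_mul_tent]

theorem measurable_rhombusEdgeDensity : Measurable rhombusEdgeDensity := by
  unfold rhombusEdgeDensity
  refine Measurable.mul (by fun_prop) ?_
  refine Measurable.ite (measurableSet_lt measurable_id measurable_const) measurable_const ?_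
  refine Measurable.ite (measurableSet_le measurable_id measurable_const) (by fun_prop) ?_
  refine Measurable.ite (measurableSet_le measurable_id measurable_const) (by fun_prop) ?_
  refine Measurable.ite (measurableSet_le measurable_id measurable_const) (by fun_prop) ?_
  exact Measurable.ite (measurableSet_le measurable_id measurable_const) (by fun_prop)
    measurable_const

theorem lintegral_eq_mul_lintegral_comp_mul_left {k : ℝ} (hk : 0 < k) {f : ℝ → ℝ≥0∞}
    (hf : Measurable f) : ∫⁻ x, f x = ENNReal.ofReal k * ∫⁻ y, f (k * y) := by
  have h : ∫⁻ y, f (k * y) = ∫⁻ x, f x ∂(volume.map (k * ·)) :=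
    (lintegral_map hf (by fun_prop)).symm
  rw [h, Real.map_volume_mul_left hk.ne', lintegral_smul_measure, smul_eq_mul, ← mul_assoc,
    ← ENNReal.ofReal_mul hk.le, abs_of_pos (by positivity), mul_inv_cancel₀ hk.ne',
    ENNReal.ofReal_one, one_mul]

theorem rhombusDifferenceDensity_eq_angularDensity_add {c θ : ℝ} (hc : 0 < c)
    (hθ : θ ∈ Ioo 0 Real.pi) :
    rhombusDifferenceDensity (c * Real.cos (θ + Real.pi / 6)) (c * Real.sin θ)
      = angularDensity c θ + angularDensity c (Real.pi - θ) := by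
  have hs : 0 < c * Real.sin θ := mul_pos hc (Real.sin_pos_of_mem_Ioo hθ)
  have h1 : Real.cos (Real.pi - θ - Real.pi / 6) = -Real.cos (θ + Real.pi / 6) := by
    rw [← Real.cos_pi_sub]; congr 1; ring
  have h2 : c * Real.cos (θ + Real.pi / 6) + c * Real.sin θ = c * Real.cos (θ - Real.pi / 6) := by
    rw [Real.cos_add, Real.cos_sub, Real.sin_pi_div_six]; ring
  unfold rhombusDifferenceDensity angularDensity
  rw [h1, Real.sin_pi_sub]
  by_cases hw : c * Real.sin θ ≤ 1
  · rw [if_pos ⟨hs.le, by linarith⟩, if_pos hw, if_pos hw, min_eq_right hw,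
      max_eq_left (by linarith), h2, mul_neg, tentPrimitive_neg, add_zero, sub_eq_add_neg]
  · push Not at hw
    rw [if_neg hw.not_ge, if_neg hw.not_ge]
    by_cases hw2 : c * Real.sin θ ≤ 2
    · rw [if_pos ⟨hs.le, hw2⟩, if_pos hw2, if_pos hw2, min_eq_left hw.le,
        max_eq_right (by linarith), ← neg_sub (c * Real.cos (θ - Real.pi / 6)) 1,
        tentPrimitive_neg, ← h2, ← add_sub_assoc, mul_neg, sub_neg_eq_add, add_comm _ (1 : ℝ)]
      ring
    · rw [if_neg (fun h => hw2 h.2), if_neg hw2, if_neg hw2, add_zero]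

theorem rhombusDifferenceDensity_of_nonpos {a b : ℝ} (hb : b ≤ 0) :
    rhombusDifferenceDensity a b = 0 := by
  unfold rhombusDifferenceDensity
  split_ifs with h
  · rw [le_antisymm hb h.1]; norm_num
  · rfl

theorem hasIntervalIntegral_rhombusDifferenceDensity {c : ℝ} (hc : 0 < c) :
    HasIntervalIntegral
      (fun θ => rhombusDifferenceDensity (c * Real.cos (θ + Real.pi / 6)) (c * Real.sin θ))
      0 Real.pi (rhombusEdgeDensity (√3 / 2 * c) / c) := by
  have h := hasIntervalIntegral_angularDensity_rhombusEdgeDensity hc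
  have h' : HasIntervalIntegral (fun θ => angularDensity c (Real.pi - θ)) 0 Real.pi
      (rhombusEdgeDensity (√3 / 2 * c) / (2 * c)) := by
    refine ⟨?_, ?_⟩
    · simpa using (h.1.comp_sub_left Real.pi).symm
    · rw [intervalIntegral.integral_comp_sub_left (angularDensity c), sub_self, sub_zero, h.2]
  have hadd : HasIntervalIntegral (fun θ => angularDensity c θ + angularDensity c (Real.pi - θ))
      0 Real.pi (rhombusEdgeDensity (√3 / 2 * c) / c) := by
    refine ⟨h.1.add h'.1, ?_⟩
    rw [intervalIntegral.integral_add h.1 h'.1, h.2, h'.2]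
    field_simp; ring
  exact hadd.congr Real.pi_pos.le fun θ hθ =>
    rhombusDifferenceDensity_eq_angularDensity_add hc hθ

theorem rhombusEdgeDensity_nonneg (d : ℝ) : 0 ≤ rhombusEdgeDensity d := by
  rcases le_or_gt d 0 with hd | hd
  · rcases hd.eq_or_lt with rfl | hd
    · simp [rhombusEdgeDensity]
    · simp [rhombusEdgeDensity, hd]
  · have hc : 0 < 2 / √3 * d := by positivity
    have h := (hasIntervalIntegral_rhombusDifferenceDensity hc).2
    rw [show √3 / 2 * (2 / √3 * d) = d by field_simp, eq_div_iff hc.ne'] at h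
    rw [← h]
    exact mul_nonneg (intervalIntegral.integral_nonneg Real.pi_pos.le
      fun θ _ => rhombusDifferenceDensity_nonneg _ _) hc.le

theorem lintegral_rhombusDifferenceDensity {r : ℝ} (hr : 0 < r) :
    ∫⁻ θ in Ioo (-Real.pi) Real.pi, ENNReal.ofReal (rhombusDifferenceDensity
        (2 / √3 * r * Real.cos (θ + Real.pi / 6)) (2 / √3 * r * Real.sin θ))
      = ENNReal.ofReal (rhombusEdgeDensity r / (2 / √3 * r)) := by
  have hp := Real.pi_pos
  have hc : 0 < 2 / √3 * r := by positivity
  have h := hasIntervalIntegral_rhombusDifferenceDensity hc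
  rw [show √3 / 2 * (2 / √3 * r) = r by field_simp] at h
  rw [← h.2, intervalIntegral.integral_of_le hp.le, integral_Ioc_eq_integral_Ioo,
    ofReal_integral_eq_lintegral_ofReal]
  · symm
    rw [← lintegral_indicator measurableSet_Ioo, ← lintegral_indicator measurableSet_Ioo]
    congr 1 with θ
    by_cases h1 : θ ∈ Ioo 0 Real.pi
    · rw [indicator_of_mem h1, indicator_of_mem (Ioo_subset_Ioo_left (by linarith) h1)]
    rw [indicator_of_notMem h1]
    by_cases h2 : θ ∈ Ioo (-Real.pi) Real.pi
    · have hθ0 : θ ≤ 0 := not_lt.1 fun h0 => h1 ⟨h0, h2.2⟩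
      rw [indicator_of_mem h2, rhombusDifferenceDensity_of_nonpos, ENNReal.ofReal_zero]
      exact mul_nonpos_of_nonneg_of_nonpos hc.le
        (Real.sin_nonpos_of_nonpos_of_neg_pi_le hθ0 h2.1.le)
    · rw [indicator_of_notMem h2]
  · exact ((intervalIntegrable_iff_integrableOn_Ioo_of_le hp.le).1 h.1)
  · exact Filter.Eventually.of_forall fun θ => rhombusDifferenceDensity_nonneg _ _

theorem lintegral_norm_mul_rhombusDifferenceDensity {F : ℝ → ℝ≥0∞} (hF : Measurable F) :
    ∫⁻ a, ∫⁻ b, F √(a ^ 2 + a * b + b ^ 2) * ENNReal.ofReal (rhombusDifferenceDensity a b)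
      = ∫⁻ r, F r * ENNReal.ofReal (rhombusEdgeDensity r) := by
  have hm := measurable_rhombusDifferenceDensity
  have hm2 : ∀ {α : Type} [MeasurableSpace α] {f g : α → ℝ}, Measurable f → Measurable g →
      Measurable fun x => rhombusDifferenceDensity (f x) (g x) :=
    fun hf hg => hm.comp (hf.prodMk hg)
  have h3 : √3 ^ 2 = 3 := Real.sq_sqrt (by norm_num)
  have hG : Measurable fun p : ℝ × ℝ => F √(p.1 ^ 2 + p.1 * p.2 + p.2 ^ 2) *
      ENNReal.ofReal (rhombusDifferenceDensity p.1 p.2) := by fun_prop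
  have hK : Measurable fun p : ℝ × ℝ => F √(p.1 ^ 2 + p.2 ^ 2) *
      ENNReal.ofReal (rhombusDifferenceDensity (p.1 - p.2 / √3) (2 / √3 * p.2)) := by
    refine Measurable.mul (by fun_prop) (ENNReal.measurable_ofReal.comp (hm2 ?_ ?_)) <;> fun_prop
  have hsupp : ∀ r ≤ 0, rhombusEdgeDensity r = 0 := by
    intro r hr
    rcases hr.eq_or_lt with rfl | hr
    · simp [rhombusEdgeDensity]
    · simp [rhombusEdgeDensity, hr]
  calc _ = ∫⁻ b, ∫⁻ a, F √(a ^ 2 + a * b + b ^ 2) *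
        ENNReal.ofReal (rhombusDifferenceDensity a b) :=
        lintegral_lintegral_swap hG.aemeasurable
    _ = ENNReal.ofReal (2 / √3) * ∫⁻ y, ∫⁻ a, F √(a ^ 2 + a * (2 / √3 * y) + (2 / √3 * y) ^ 2) *
          ENNReal.ofReal (rhombusDifferenceDensity a (2 / √3 * y)) :=
        lintegral_eq_mul_lintegral_comp_mul_left (by positivity)
          (hG.comp measurable_swap).lintegral_prod_right'
    _ = ENNReal.ofReal (2 / √3) * ∫⁻ y, ∫⁻ x, F √(x ^ 2 + y ^ 2) *
          ENNReal.ofReal (rhombusDifferenceDensity (x - y / √3) (2 / √3 * y)) := by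
        congr 2 with y
        rw [← lintegral_sub_right_eq_self _ (y / √3)]
        congr 1 with x
        congr 3
        field_simp
        linear_combination (-(y ^ 2)) * h3
    _ = ENNReal.ofReal (2 / √3) * ∫⁻ p : ℝ × ℝ, F √(p.1 ^ 2 + p.2 ^ 2) *
          ENNReal.ofReal (rhombusDifferenceDensity (p.1 - p.2 / √3) (2 / √3 * p.2)) := by
        rw [Measure.volume_eq_prod, lintegral_prod_symm' _ hK]
    _ = ENNReal.ofReal (2 / √3) * ∫⁻ r in Ioi (0 : ℝ), ∫⁻ θ in Ioo (-Real.pi) Real.pi,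
          ENNReal.ofReal r * (F r * ENNReal.ofReal (rhombusDifferenceDensity
            (2 / √3 * r * Real.cos (θ + Real.pi / 6)) (2 / √3 * r * Real.sin θ))) := by
        rw [← lintegral_comp_polarCoord_symm, polarCoord_target, Measure.volume_eq_prod,
          ← Measure.prod_restrict, lintegral_prod]
        · congr 1
          refine setLIntegral_congr_fun measurableSet_Ioi fun r hr => ?_
          congr 1 with θ
          rw [polarCoord_symm_apply, smul_eq_mul]
          have e1 : (r * Real.cos θ) ^ 2 + (r * Real.sin θ) ^ 2 = r ^ 2 := by
            linear_combination r ^ 2 * Real.sin_sq_add_cos_sq θ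
          have e2 : r * Real.cos θ - r * Real.sin θ / √3
              = 2 / √3 * r * Real.cos (θ + Real.pi / 6) := by
            rw [Real.cos_add, Real.sin_pi_div_six, Real.cos_pi_div_six]
            field_simp
          simp only [e1, e2, Real.sqrt_sq (le_of_lt hr), mul_assoc]
        · refine Measurable.aemeasurable ?_
          exact (measurable_fst.ennreal_ofReal).smul
            (hK.comp continuous_polarCoord_symm.measurable)
    _ = ∫⁻ r in Ioi (0 : ℝ), F r * ENNReal.ofReal (rhombusEdgeDensity r) := by
        rw [← lintegral_const_mul']
        · refine setLIntegral_congr_fun measurableSet_Ioi fun r hr => ?_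
          have hr : 0 < r := hr
          have hmθ : Measurable fun θ : ℝ => ENNReal.ofReal (rhombusDifferenceDensity
              (2 / √3 * r * Real.cos (θ + Real.pi / 6)) (2 / √3 * r * Real.sin θ)) :=
            ENNReal.measurable_ofReal.comp (hm2 (by fun_prop) (by fun_prop))
          rw [lintegral_const_mul _ (hmθ.const_mul _), lintegral_const_mul _ hmθ,
            lintegral_rhombusDifferenceDensity hr]
          have : ENNReal.ofReal (rhombusEdgeDensity r) = ENNReal.ofReal (2 / √3) *
              (ENNReal.ofReal r * ENNReal.ofReal (rhombusEdgeDensity r / (2 / √3 * r))) := by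
            rw [← ENNReal.ofReal_mul hr.le, ← ENNReal.ofReal_mul (by positivity)]
            congr 1
            field_simp
          rw [this]
          ring
        · exact ENNReal.ofReal_ne_top
    _ = _ := by
        rw [← lintegral_indicator measurableSet_Ioi]
        congr 1 with r
        by_cases hr : r ∈ Ioi (0 : ℝ)
        · rw [indicator_of_mem hr]
        · rw [indicator_of_notMem hr, hsupp r (not_lt.1 hr), ENNReal.ofReal_zero, mul_zero]

namespace UnitRhombus

/-- The affine parametrization of a rhombus by the unit square. -/
noncomputable def param (R : UnitRhombus) (p : ℝ × ℝ) : Plane := R.corner + (p.1 • R.u + p.2 • R.v)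

theorem image_param (R : UnitRhombus) : R.param '' (Icc 0 1 ×ˢ Icc 0 1) = R.region := by
  ext x
  simp only [region, param, mem_image, mem_prod, Prod.exists, mem_ofPred_eq]
  constructor
  · rintro ⟨s, t, ⟨hs, ht⟩, rfl⟩
    exact ⟨s, hs, t, ht, by abel⟩
  · rintro ⟨s, hs, t, ht, rfl⟩
    exact ⟨s, t, ⟨hs, ht⟩, by abel⟩

theorem inner_uv (R : UnitRhombus) : inner ℝ R.u R.v = 1 / 2 := by
  have h := InnerProductGeometry.cos_angle R.u R.v
  rw [R.angle_uv, R.norm_u, R.norm_v, Real.cos_pi_div_three] at h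
  linarith

theorem norm_smul_add_smul (R : UnitRhombus) (a b : ℝ) :
    ‖a • R.u + b • R.v‖ = √(a ^ 2 + a * b + b ^ 2) := by
  rw [← Real.sqrt_sq (norm_nonneg (a • R.u + b • R.v)), norm_add_sq_real, inner_smul_left,
    inner_smul_right, inner_uv, norm_smul, norm_smul, R.norm_u, R.norm_v]
  simp only [mul_one, Real.norm_eq_abs, sq_abs, conj_trivial]
  congr 1; ring

theorem smul_add_smul_eq_zero (R : UnitRhombus) {a b : ℝ} (h : a • R.u + b • R.v = 0) :
    a = 0 ∧ b = 0 := by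
  have h1 := R.norm_smul_add_smul a b
  rw [h, norm_zero] at h1
  have h2 : a ^ 2 + a * b + b ^ 2 ≤ 0 := Real.sqrt_eq_zero'.1 h1.symm
  constructor <;> nlinarith [sq_nonneg (a + b), sq_nonneg a, sq_nonneg b]

/-- The linear part of the parametrization. -/
noncomputable def linearParam (R : UnitRhombus) : (ℝ × ℝ) ≃L[ℝ] Plane :=
  (LinearMap.linearEquivOfInjective
    ((LinearMap.fst ℝ ℝ ℝ).smulRight R.u + (LinearMap.snd ℝ ℝ ℝ).smulRight R.v)
    (by
      rw [← LinearMap.ker_eq_bot, LinearMap.ker_eq_bot']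
      intro p hp
      obtain ⟨h1, h2⟩ := R.smul_add_smul_eq_zero (a := p.1) (b := p.2) (by simpa using hp)
      exact Prod.ext h1 h2)
    (by simp)).toContinuousLinearEquiv

theorem param_eq (R : UnitRhombus) : R.param = (R.corner + ·) ∘ R.linearParam := rfl

theorem measurableEmbedding_param (R : UnitRhombus) : MeasurableEmbedding R.param :=
  (measurableEmbedding_addLeft R.corner).comp
    R.linearParam.toHomeomorph.measurableEmbedding

theorem map_eq_map_param (R : UnitRhombus) {Ω : Type*} [MeasurableSpace Ω] {P : Measure Ω}
    {X : Ω → Plane} (hX : pdf.IsUniform X R.region P volume) :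
    P.map X = (volume.restrict (Icc (0 : ℝ) 1 ×ˢ Icc (0 : ℝ) 1)).map R.param := by
  obtain ⟨k, hk⟩ : ∃ k : ℝ≥0∞, (volume : Measure (ℝ × ℝ)).map R.param = k • volume := by
    have : (volume.map R.linearParam).IsAddHaarMeasure :=
      R.linearParam.isAddHaarMeasure_map volume
    obtain ⟨k, hk⟩ : ∃ k : NNReal, volume.map R.linearParam = k • (volume : Measure Plane) :=
      ⟨_, Measure.isAddLeftInvariant_eq_smul _ _⟩
    refine ⟨k, ?_⟩
    rw [param_eq, ← Measure.map_map (measurable_const_add _)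
      R.linearParam.continuous.measurable, hk, Measure.map_smul, map_add_left_eq_self]
    rfl
  have h1 : (volume.restrict (Icc (0 : ℝ) 1 ×ˢ Icc (0 : ℝ) 1)).map R.param
      = k • volume.restrict R.region := by
    rw [← Measure.restrict_smul, ← hk, ← image_param, R.measurableEmbedding_param.restrict_map,
      R.measurableEmbedding_param.injective.preimage_image]
  have h2 : k * volume R.region = 1 := by
    have h := congrArg (fun μ => μ univ) h1
    simp only [Measure.smul_apply, Measure.restrict_apply_univ, smul_eq_mul] at h
    rw [← h, Measure.map_apply R.measurableEmbedding_param.measurable MeasurableSet.univ,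
      preimage_univ, Measure.restrict_apply_univ, Measure.volume_eq_prod, Measure.prod_prod]
    simp
  rw [h1, hX, ProbabilityTheory.cond, ENNReal.eq_inv_of_mul_eq_one_left h2]

theorem exists_region_eq_segment_eq (R : UnitRhombus) {S : Set Plane} (hS : S ∈ R.sides) :
    ∃ R' : UnitRhombus, R'.region = R.region ∧ S = segment ℝ R'.corner (R'.corner + R'.u) := by
  have hπ : InnerProductGeometry.angle R.v R.u = Real.pi / 3 := by
    rw [InnerProductGeometry.angle_comm, R.angle_uv]
  rcases hS with rfl | rfl | rfl | rfl
  · exact ⟨R, rfl, rfl⟩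
  · refine ⟨⟨R.corner, R.v, R.u, R.norm_v, R.norm_u, hπ⟩, ?_, rfl⟩
    ext x
    constructor <;> rintro ⟨s, hs, t, ht, rfl⟩ <;>
      exact ⟨t, ht, s, hs, by simp only; abel⟩
  · refine ⟨⟨R.corner + R.u + R.v, -R.v, -R.u, by rw [norm_neg, R.norm_v],
      by rw [norm_neg, R.norm_u], by rw [InnerProductGeometry.angle_neg_neg, hπ]⟩, ?_, ?_⟩
    · ext x
      constructor <;> rintro ⟨s, hs, t, ht, rfl⟩ <;>
        exact ⟨1 - t, ⟨by linarith [ht.2], by linarith [ht.1]⟩, 1 - s,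
          ⟨by linarith [hs.2], by linarith [hs.1]⟩, by simp only; module⟩
    · rw [segment_symm]; congr 1; simp only; abel
  · refine ⟨⟨R.corner + R.u + R.v, -R.u, -R.v, by rw [norm_neg, R.norm_u],
      by rw [norm_neg, R.norm_v], by rw [InnerProductGeometry.angle_neg_neg, R.angle_uv]⟩, ?_, ?_⟩
    · ext x
      constructor <;> rintro ⟨s, hs, t, ht, rfl⟩ <;>
        exact ⟨1 - s, ⟨by linarith [hs.2], by linarith [hs.1]⟩, 1 - t,
          ⟨by linarith [ht.2], by linarith [ht.1]⟩, by simp only; module⟩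
    · rw [segment_symm]; congr 1; simp only; abel

/-- In the plane, only two unit vectors make the angle `π / 3` with a given unit vector. -/
theorem eq_or_eq_sub_of_inner_eq (R : UnitRhombus) {w : Plane} (hw : ‖w‖ = 1)
    (h : inner ℝ R.u w = 1 / 2) : w = R.v ∨ w = R.u - R.v := by
  have hu := R.norm_u
  have hv := R.norm_v
  have huv := R.inner_uv
  rw [EuclideanSpace.norm_eq, Real.sqrt_eq_one, Fin.sum_univ_two] at hu hv hw
  simp only [Real.norm_eq_abs, sq_abs, PiLp.inner_apply, Fin.sum_univ_two, RCLike.inner_apply,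
    conj_trivial] at hu hv hw huv h
  have hc : (R.u 0 * w 1 - R.u 1 * w 0 - (R.u 0 * R.v 1 - R.u 1 * R.v 0))
      * (R.u 0 * w 1 - R.u 1 * w 0 + (R.u 0 * R.v 1 - R.u 1 * R.v 0)) = 0 := by
    grind
  rcases mul_eq_zero.1 hc with hc | hc
  · left
    ext i
    fin_cases i <;> simp only [Fin.zero_eta, Fin.mk_one]
    · linear_combination (R.v 0 - w 0) * hu + R.u 0 * (h - huv) - R.u 1 * hc
    · linear_combination (R.v 1 - w 1) * hu + R.u 1 * (h - huv) + R.u 0 * hc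
  · right
    ext i
    fin_cases i <;> simp only [Fin.zero_eta, Fin.mk_one, PiLp.sub_apply]
    · linear_combination (-R.v 0 - w 0) * hu + R.u 0 * (h + huv) - R.u 1 * hc
    · linear_combination (-R.v 1 - w 1) * hu + R.u 1 * (h + huv) + R.u 0 * hc

theorem add_smul_notMem_segment (R : UnitRhombus) {a b : ℝ} (hb : b ≠ 0) :
    R.corner + (a • R.u + b • R.v) ∉ segment ℝ R.corner (R.corner + R.u) := by
  rw [segment_eq_image']
  rintro ⟨θ, -, h⟩
  simp only [add_sub_cancel_left] at h
  refine hb (R.smul_add_smul_eq_zero (a := a - θ) (b := b) ?_).2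
  rw [add_right_inj] at h
  rw [sub_smul, h]; module

theorem eq_endpoints_of_segment_eq {c u c' u' : Plane} (hu : ‖u‖ = 1) (hu' : ‖u'‖ = 1)
    (h : segment ℝ c (c + u) = segment ℝ c' (c' + u')) :
    (c' = c ∧ u' = u) ∨ (c' = c + u ∧ u' = -u) := by
  have h1 : c' ∈ segment ℝ c (c + u) := h ▸ left_mem_segment ℝ _ _
  have h2 : c' + u' ∈ segment ℝ c (c + u) := h ▸ right_mem_segment ℝ _ _
  rw [segment_eq_image'] at h1 h2
  obtain ⟨a, ⟨ha0, ha1⟩, ha⟩ := h1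
  obtain ⟨b, ⟨hb0, hb1⟩, hb⟩ := h2
  simp only [add_sub_cancel_left] at ha hb
  have hu2 : u' = (b - a) • u := by
    rw [← ha, add_assoc, add_right_inj] at hb
    rw [sub_smul, hb]; abel
  rw [hu2, norm_smul, hu, mul_one, Real.norm_eq_abs] at hu'
  rcases eq_or_eq_neg_of_abs_eq hu' with hab | hab
  · left
    have : a = 0 := by linarith
    subst this
    exact ⟨by rw [← ha]; simp, by rw [hu2, hab, one_smul]⟩
  · right
    have : a = 1 := by linarith
    subst this
    exact ⟨by rw [← ha]; simp, by rw [hu2, hab, neg_smul, one_smul]⟩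

/-- Adjacent rhombuses of different orientations are mirror images in the common side. -/
theorem exists_mirror {E F : UnitRhombus} (hside : E.ShareSide F)
    (horient : ¬ E.SameOrientation F) :
    ∃ E' F' : UnitRhombus, E'.region = E.region ∧ F'.region = F.region ∧
      F'.corner = E'.corner ∧ F'.u = E'.u ∧ F'.v = E'.u - E'.v := by
  obtain ⟨S, hE, hF, hS⟩ := hside
  obtain ⟨E', hE', rfl⟩ := E.exists_region_eq_segment_eq hE
  obtain ⟨F', hF', hF2⟩ := F.exists_region_eq_segment_eq hF
  refine ⟨E', F', hE', hF', ?_⟩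
  unfold SameOrientation at horient
  rw [← hE', ← hF'] at hS horient
  rcases eq_endpoints_of_segment_eq E'.norm_u F'.norm_u hF2 with ⟨hc, hu⟩ | ⟨hc, hu⟩
  · rcases E'.eq_or_eq_sub_of_inner_eq F'.norm_v (by rw [← hu, F'.inner_uv]) with hv | hv
    · exact (horient ⟨0, by simp [region, hc, hu, hv]⟩).elim
    · exact ⟨hc, hu, hv⟩
  · exfalso
    have hi : inner ℝ E'.u (-F'.v) = 1 / 2 := by
      rw [inner_neg_right, ← inner_neg_left, ← hu, F'.inner_uv]
    rcases E'.eq_or_eq_sub_of_inner_eq (by rw [norm_neg, F'.norm_v]) hi with hv | hv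
    · refine horient ⟨-E'.v, ?_⟩
      rw [neg_eq_iff_eq_neg] at hv
      ext x
      simp only [region, hc, hu, hv, mem_image, mem_ofPred_eq]
      constructor
      · rintro ⟨s, hs, t, ht, rfl⟩
        exact ⟨_, ⟨1 - s, ⟨by linarith [hs.2], by linarith [hs.1]⟩, 1 - t,
          ⟨by linarith [ht.2], by linarith [ht.1]⟩, rfl⟩, by module⟩
      · rintro ⟨_, ⟨s, hs, t, ht, rfl⟩, rfl⟩
        exact ⟨1 - s, ⟨by linarith [hs.2], by linarith [hs.1]⟩, 1 - t,
          ⟨by linarith [ht.2], by linarith [ht.1]⟩, by module⟩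
    · rw [neg_eq_iff_eq_neg] at hv
      refine E'.add_smul_notMem_segment (a := 1 / 3) (b := 1 / 3) (by norm_num) ?_
      rw [← hS]
      refine ⟨⟨1 / 3, by norm_num, 1 / 3, by norm_num, by module⟩,
        ⟨1 / 3, by norm_num, 1 / 3, by norm_num, ?_⟩⟩
      rw [hc, hu, hv]; module

end UnitRhombus

theorem mainTheorem3 {Ω : Type*} [MeasurableSpace Ω] (P : Measure Ω) [IsProbabilityMeasure P]
    (E F : UnitRhombus) (hside : E.ShareSide F) (horient : ¬ E.SameOrientation F)
    (X Y : Ω → Plane)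
    (hX : pdf.IsUniform X E.region P volume)
    (hY : pdf.IsUniform Y F.region P volume)
    (hXY : IndepFun X Y P) :
    (∀ d : ℝ, 0 ≤ rhombusEdgeDensity d) ∧
    HasPDF (fun ω => dist (X ω) (Y ω)) P volume ∧
    pdf (fun ω => dist (X ω) (Y ω)) P volume
      =ᵐ[volume] fun d => ENNReal.ofReal (rhombusEdgeDensity d) := by
  obtain ⟨E', F', hE', hF', hc, hu, hv⟩ := UnitRhombus.exists_mirror hside horient
  rw [← hE'] at hX
  rw [← hF'] at hY
  have hX' := E'.map_eq_map_param hX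
  have hY' := F'.map_eq_map_param hY
  have hne : ∀ R : UnitRhombus,
      (volume.restrict (Icc (0 : ℝ) 1 ×ˢ Icc (0 : ℝ) 1)).map R.param ≠ 0 := by
    intro R h
    rw [Measure.map_eq_zero_iff R.measurableEmbedding_param.measurable.aemeasurable,
      Measure.restrict_eq_zero, Measure.volume_eq_prod, Measure.prod_prod] at h
    simp at h
  have hXm : AEMeasurable X P := AEMeasurable.of_map_ne_zero (hX' ▸ hne E')
  have hYm : AEMeasurable Y P := AEMeasurable.of_map_ne_zero (hY' ▸ hne F')
  have hDm : AEMeasurable (fun ω => dist (X ω) (Y ω)) P := hXm.dist hYm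
  have hf : Measurable fun d => ENNReal.ofReal (rhombusEdgeDensity d) :=
    measurable_rhombusEdgeDensity.ennreal_ofReal
  have hlaw : P.map (fun ω => dist (X ω) (Y ω))
      = volume.withDensity fun d => ENNReal.ofReal (rhombusEdgeDensity d) := by
    ext A hA
    have hF : Measurable (A.indicator (1 : ℝ → ℝ≥0∞)) := measurable_one.indicator hA
    have hEm := E'.measurableEmbedding_param.measurable
    have hFm := F'.measurableEmbedding_param.measurable
    have hmap : P.map (fun ω => dist (X ω) (Y ω))
        = (((volume.restrict (Icc (0 : ℝ) 1)).prod (volume.restrict (Icc (0 : ℝ) 1))).prod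
          ((volume.restrict (Icc (0 : ℝ) 1)).prod (volume.restrict (Icc (0 : ℝ) 1)))).map
          (fun q => dist (E'.param q.1) (F'.param q.2)) := by
      have h := (indepFun_iff_map_prod_eq_prod_map_map hXm hYm).1 hXY
      rw [hX', hY', Measure.map_prod_map _ _ hEm hFm, Measure.volume_eq_prod,
        ← Measure.prod_restrict] at h
      have h2 := AEMeasurable.map_map_of_aemeasurable (g := fun z : Plane × Plane => dist z.1 z.2)
        (measurable_dist.aemeasurable) (hXm.prodMk hYm)
      rw [h, Measure.map_map measurable_dist (hEm.prodMap hFm)] at h2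
      exact h2.symm
    have hdist : ∀ s t s' t' : ℝ, dist (E'.param (s, t)) (F'.param (s', t'))
        = √((s - s' - t') ^ 2 + (s - s' - t') * (t + t') + (t + t') ^ 2) := by
      intro s t s' t'
      rw [← E'.norm_smul_add_smul, dist_eq_norm, UnitRhombus.param, UnitRhombus.param, hc, hu, hv]
      congr 1
      module
    rw [withDensity_apply _ hA, ← lintegral_indicator hA, ← lintegral_indicator_one hA, hmap,
      lintegral_map hF (by fun_prop), lintegral_prod _ (by fun_prop),
      lintegral_prod _ (by fun_prop)]
    have hinner : ∀ s t, ∫⁻ q, A.indicator 1 (dist (E'.param (s, t)) (F'.param q))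
        ∂((volume.restrict (Icc (0 : ℝ) 1)).prod (volume.restrict (Icc (0 : ℝ) 1)))
        = ∫⁻ s' in Icc (0 : ℝ) 1, ∫⁻ t' in Icc (0 : ℝ) 1, A.indicator (1 : ℝ → ℝ≥0∞)
          √((s - s' - t') ^ 2 + (s - s' - t') * (t + t') + (t + t') ^ 2) := by
      intro s t
      rw [lintegral_prod _ (by fun_prop)]
      simp_rw [hdist]
    simp_rw [hinner]
    rw [lintegral_unitSquare_prod_unitSquare (G := fun p : ℝ × ℝ => A.indicator (1 : ℝ → ℝ≥0∞)
      √(p.1 ^ 2 + p.1 * p.2 + p.2 ^ 2)) (by fun_prop),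
      lintegral_norm_mul_rhombusDifferenceDensity hF]
    congr 1 with r
    by_cases hr : r ∈ A <;> simp [hr]
  have hpdf : HasPDF (fun ω => dist (X ω) (Y ω)) P volume :=
    hasPDF_of_map_eq_withDensity hDm _ hf.aemeasurable hlaw
  exact ⟨rhombusEdgeDensity_nonneg, hpdf, pdf.eq_of_map_eq_withDensity _ hf.aemeasurable |>.1 hlaw⟩
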